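/- Let $n\in\mathbb{N}$ and let $A,B$ be $n\times n$ complex matrices with $A$ positive semidefinite and $B$ positive definite. Powers and logarithms of positive semidefinite matrices are taken in the sense of functional calculus, with $\log 0:=0$ on the kernel of a singular matrix (which amounts to the usual convention $0\log 0=0$). Then all the traces below are real, and \begin{align*} \mathrm{Tr}\, AB^{-1}A(\log A-\log B) &\le\mathrm{Tr}\, A^{1/2}B^{-1}A^{3/2}\log(A^{1/2}B^{-1}A^{1/2})\\ &=\mathrm{Tr}\, B^{-1/2}A^2B^{-1/2}\log(B^{-1/2}AB^{-1/2})\\ &=\mathrm{Tr}\, A^{3/2}B^{-1}A^{1/2}\log(A^{1/2}B^{-1}A^{1/2})\\ &\le\mathrm{Tr}\, A^2B^{-1}(\log A-\log B). \end{align*} -/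

import Mathlib

open scoped MatrixOrder ComplexOrder

/-! Write `M = A^(1/2) B⁻¹ A^(1/2)` and `N = B^(-1/2) A B^(-1/2)`. With `T = A^(1/2) B^(-1/2)` one
has `M = T Tᴴ` and `N = Tᴴ T`, so `f(M) T = T f(N)`; this and cyclicity of the trace give both
equalities.

Each inequality compares two sums `∑ weight * log point`, obtained by expanding the traces in
eigenbases. As `log t = ∫₀^∞ (1/(1+s) - 1/(t+s)) ds`, for equal total mass it suffices to compare `∑
weight / (point + s)` for every `s > 0` (`sum_mul_log_le_sum_mul_log_of_resolvent_le`).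

Both resolvent comparisons are variational. For the first (`sum_resolvent_conj_sqrt_le`), the side
with the points `μ/a` is a minimum of a quadratic functional; the trial matrix `A^(1/2) (B⁻¹ + s)⁻¹`
bounds it by an expression in the eigenvalues of `B` and the entries of `A`, and symmetrising
finishes. For the second (`sum_resolvent_le_conj_rsqrt`), the side with the points `a/b` is the
maximum of a quadratic functional, whose value at the maximiser is re-expanded in the eigenbasis of
`N` and bounded there by completing squares. -/

open Filter Topology in
/-- If two finite weight distributions have the same mass and their Stieltjes transforms are
ordered, then their logarithmic integrals are ordered the other way round. -/
theorem sum_mul_log_le_sum_mul_log_of_resolvent_le {ι κ : Type*} [Fintype ι] [Fintype κ]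
    {α t : ι → ℝ} {β r : κ → ℝ}
    (ht : ∀ i, 0 ≤ t i) (hr : ∀ k, 0 ≤ r k)
    (hαt : ∀ i, t i = 0 → α i = 0) (hβr : ∀ k, r k = 0 → β k = 0)
    (hsum : ∑ i, α i = ∑ k, β k)
    (hres : ∀ s : ℝ, 0 < s → ∑ i, α i / (t i + s) ≤ ∑ k, β k / (r k + s)) :
    ∑ k, β k * Real.log (r k) ≤ ∑ i, α i * Real.log (t i) := by
  set F : ℝ → ℝ := fun s =>
    ∑ i, α i * Real.log (t i + s) - ∑ k, β k * Real.log (r k + s) with hF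
  have hderiv : ∀ s ∈ Set.Ioi (0 : ℝ), HasDerivAt F
      (∑ i, α i * (1 / (t i + s)) - ∑ k, β k * (1 / (r k + s))) s := by
    intro s hs
    have hs : 0 < s := hs
    refine HasDerivAt.sub (HasDerivAt.fun_sum fun i _ => ?_) (HasDerivAt.fun_sum fun i _ => ?_)
    · exact (((hasDerivAt_id s).const_add (t i)).log (by have := ht i; simp; positivity)).const_mul _
    · exact (((hasDerivAt_id s).const_add (r i)).log (by have := hr i; simp; positivity)).const_mul _
  have hanti : AntitoneOn F (Set.Ioi 0) := by
    refine antitoneOn_of_deriv_nonpos (convex_Ioi 0)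
      (fun s hs => (hderiv s hs).continuousAt.continuousWithinAt)
      (fun s hs => (hderiv s (by simpa using hs)).differentiableAt.differentiableWithinAt) ?_
    intro s hs
    have hs : s ∈ Set.Ioi (0 : ℝ) := by simpa using hs
    rw [(hderiv s hs).deriv]
    have := hres s hs
    simp only [mul_one_div]
    linarith
  have hlog : ∀ x : ℝ, 0 ≤ x →
      Tendsto (fun s : ℝ => Real.log (x + s) - Real.log s) atTop (𝓝 0) := by
    intro x hx
    have h1 : Tendsto (fun s : ℝ => Real.log (x / s + 1)) atTop (𝓝 0) := by
      have h2 : Tendsto (fun s : ℝ => x / s + 1) atTop (𝓝 (0 + 1)) :=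
        (tendsto_const_nhds.div_atTop tendsto_id).add_const 1
      rw [zero_add] at h2
      simpa using h2.log one_ne_zero
    refine h1.congr' ?_
    filter_upwards [eventually_gt_atTop 0] with s hs
    rw [← Real.log_div (by positivity) hs.ne', add_div, div_self hs.ne']
  -- Equal masses allow `log s` to be subtracted from every logarithm.
  have hlim : Tendsto F atTop (𝓝 0) := by
    have h1 : Tendsto (fun s : ℝ => ∑ i, α i * (Real.log (t i + s) - Real.log s)
        - ∑ k, β k * (Real.log (r k + s) - Real.log s)) atTop
        (𝓝 (∑ i, α i * 0 - ∑ k, β k * 0)) :=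
      (tendsto_finsetSum _ fun i _ => (hlog _ (ht i)).const_mul _).sub
        (tendsto_finsetSum _ fun k _ => (hlog _ (hr k)).const_mul _)
    simp only [mul_zero, Finset.sum_const_zero, sub_zero] at h1
    refine h1.congr fun s => ?_
    simp only [hF, mul_sub, Finset.sum_sub_distrib, ← Finset.sum_mul, hsum]
    ring
  have hpos : ∀ s : ℝ, 0 < s → 0 ≤ F s := fun s hs =>
    le_of_tendsto hlim (by
      filter_upwards [eventually_ge_atTop s] with u hu
      exact hanti hs (lt_of_lt_of_le hs hu) hu)
  -- At a point `0` the logarithm diverges as `s → 0`, so the weight there must vanish.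
  have hzero : ∀ x y : ℝ, (x = 0 → y = 0) →
      Tendsto (fun s : ℝ => y * Real.log (x + s)) (𝓝[>] 0) (𝓝 (y * Real.log x)) := by
    intro x y hxy
    by_cases hx : x = 0
    · simp [hxy hx]
    · have h2 : Tendsto (fun s : ℝ => x + s) (𝓝[>] 0) (𝓝 (x + 0)) :=
        (tendsto_const_nhds.add tendsto_id).mono_left nhdsWithin_le_nhds
      rw [add_zero] at h2
      exact (h2.log hx).const_mul y
  have hlim0 : Tendsto F (𝓝[>] 0)
      (𝓝 (∑ i, α i * Real.log (t i) - ∑ k, β k * Real.log (r k))) :=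
    (tendsto_finsetSum _ fun i _ => hzero _ _ (hαt i)).sub
      (tendsto_finsetSum _ fun k _ => hzero _ _ (hβr k))
  have := ge_of_tendsto hlim0 (by
    filter_upwards [self_mem_nhdsWithin] with s hs using hpos s hs)
  linarith

/-! ### Functional calculus and traces in eigenbases -/

namespace Matrix

variable {n : Type*} [Fintype n] [DecidableEq n]

theorem continuousOn_real_spectrum (H : Matrix n n ℂ) (f : ℝ → ℝ) :
    ContinuousOn f (spectrum ℝ H) := by
  rw [continuousOn_iff_continuous_domRestrict]; fun_prop

theorem cfc_mul_cfc (f g : ℝ → ℝ) (H : Matrix n n ℂ) :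
    cfc f H * cfc g H = cfc (fun x => f x * g x) H :=
  (cfc_mul f g H (H.continuousOn_real_spectrum f) (H.continuousOn_real_spectrum g)).symm

theorem conjTranspose_cfc (f : ℝ → ℝ) (H : Matrix n n ℂ) : (cfc f H)ᴴ = cfc f H :=
  (cfc_predicate f H : IsSelfAdjoint (cfc f H))

theorem IsHermitian.cfc_eq_conj {H : Matrix n n ℂ} (hH : H.IsHermitian) (f : ℝ → ℝ) :
    cfc f H = (hH.eigenvectorUnitary : Matrix n n ℂ) *
      diagonal (fun i => (f (hH.eigenvalues i) : ℂ)) * (hH.eigenvectorUnitary : Matrix n n ℂ)ᴴ := by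
  rw [hH.cfc_eq, IsHermitian.cfc, Unitary.conjStarAlgAut_apply]
  rfl

theorem PosSemidef.cfc_congr {H : Matrix n n ℂ} (hH : H.PosSemidef) {f g : ℝ → ℝ}
    (hfg : ∀ x, 0 ≤ x → f x = g x) : cfc f H = cfc g H := by
  refine _root_.cfc_congr fun x hx => hfg x ?_
  rw [hH.isHermitian.spectrum_real_eq_range_eigenvalues] at hx
  obtain ⟨i, rfl⟩ := hx
  exact hH.eigenvalues_nonneg i

theorem PosDef.cfc_congr {H : Matrix n n ℂ} (hH : H.PosDef) {f g : ℝ → ℝ}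
    (hfg : ∀ x, 0 < x → f x = g x) : cfc f H = cfc g H := by
  refine _root_.cfc_congr fun x hx => hfg x ?_
  rw [hH.isHermitian.spectrum_real_eq_range_eigenvalues] at hx
  obtain ⟨i, rfl⟩ := hx
  exact hH.eigenvalues_pos i

theorem IsHermitian.cfc_id_eq {H : Matrix n n ℂ} (hH : H.IsHermitian) :
    cfc (fun x : ℝ => x) H = H := cfc_id' ℝ H hH.isSelfAdjoint

theorem IsHermitian.cfc_one_eq {H : Matrix n n ℂ} (hH : H.IsHermitian) :
    cfc (fun _ : ℝ => (1 : ℝ)) H = 1 := cfc_const_one ℝ H hH.isSelfAdjoint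

theorem PosDef.inv_eq_cfc {H : Matrix n n ℂ} (hH : H.PosDef) :
    H⁻¹ = cfc (fun x : ℝ => x⁻¹) H := by
  refine inv_eq_right_inv ?_
  conv_lhs => arg 1; rw [← hH.isHermitian.cfc_id_eq]
  rw [cfc_mul_cfc, hH.cfc_congr (g := fun _ => 1) fun x hx => mul_inv_cancel₀ hx.ne',
    hH.isHermitian.cfc_one_eq]

/-- The entries of a matrix in the eigenbases of two Hermitian matrices. -/
noncomputable def IsHermitian.coord {H K : Matrix n n ℂ} (hH : H.IsHermitian)
    (hK : K.IsHermitian) (Y : Matrix n n ℂ) : Matrix n n ℂ :=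
  (hH.eigenvectorUnitary : Matrix n n ℂ)ᴴ * Y * (hK.eigenvectorUnitary : Matrix n n ℂ)

/-- Turns traces into sums over pairs of eigenvalues; for `Y = Z` the weights are real. -/
theorem IsHermitian.trace_cfc_mul_mul_cfc_mul {H K : Matrix n n ℂ} (hH : H.IsHermitian)
    (hK : K.IsHermitian) (f g : ℝ → ℝ) (Y Z : Matrix n n ℂ) :
    (cfc f H * Y * cfc g K * Zᴴ).trace = ∑ i, ∑ j,
      (f (hH.eigenvalues i) : ℂ) * g (hK.eigenvalues j) *
        (hH.coord hK Y i j * star (hH.coord hK Z i j)) := by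
  rw [hH.cfc_eq_conj, hK.cfc_eq_conj]
  set U := (hH.eigenvectorUnitary : Matrix n n ℂ)
  set V := (hK.eigenvectorUnitary : Matrix n n ℂ)
  set D := diagonal (fun i => (f (hH.eigenvalues i) : ℂ))
  set E := diagonal (fun i => (g (hK.eigenvalues i) : ℂ))
  have h : (U * D * Uᴴ * Y * (V * E * Vᴴ) * Zᴴ).trace =
      ((D * (Uᴴ * Y * V)) * (E * (Uᴴ * Z * V)ᴴ)).trace := by
    rw [show U * D * Uᴴ * Y * (V * E * Vᴴ) * Zᴴ = U * (D * Uᴴ * Y * V * E * Vᴴ * Zᴴ) by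
      simp only [Matrix.mul_assoc], trace_mul_comm]
    simp only [conjTranspose_mul, conjTranspose_conjTranspose, Matrix.mul_assoc]
  rw [h, trace]
  simp only [diag_apply, mul_apply (M := D * (Uᴴ * Y * V)), D, E, diagonal_mul,
    conjTranspose_apply]
  refine Finset.sum_congr rfl fun i _ => Finset.sum_congr rfl fun j _ => ?_
  simp only [IsHermitian.coord, U, V]
  ring

theorem IsHermitian.trace_cfc_mul_mul_cfc_mul_self {H K : Matrix n n ℂ} (hH : H.IsHermitian)
    (hK : K.IsHermitian) (f g : ℝ → ℝ) (Y : Matrix n n ℂ) :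
    (cfc f H * Y * cfc g K * Yᴴ).trace = ((∑ i, ∑ j,
      f (hH.eigenvalues i) * g (hK.eigenvalues j) * Complex.normSq (hH.coord hK Y i j) : ℝ) : ℂ) := by
  rw [hH.trace_cfc_mul_mul_cfc_mul hK]
  push_cast
  simp only [Complex.star_def, Complex.mul_conj]

theorem IsHermitian.trace_cfc_mul_cfc {H K : Matrix n n ℂ} (hH : H.IsHermitian)
    (hK : K.IsHermitian) (f g : ℝ → ℝ) :
    (cfc f H * cfc g K).trace = ((∑ i, ∑ j,
      f (hH.eigenvalues i) * g (hK.eigenvalues j) * Complex.normSq (hH.coord hK 1 i j) : ℝ) : ℂ) := by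
  rw [← hH.trace_cfc_mul_mul_cfc_mul_self hK]
  simp

open Polynomial in
-- Interpolation on the two finite spectra replaces `f` by a polynomial, and for powers the identity
-- is associativity.
theorem cfc_mul_conjTranspose_mul (T : Matrix n n ℂ) (f : ℝ → ℝ) :
    cfc f (T * Tᴴ) * T = T * cfc f (Tᴴ * T) := by
  classical
  obtain ⟨q, hq⟩ : ∃ q : ℝ[X], ∀ x ∈ spectrum ℝ (T * Tᴴ) ∪ spectrum ℝ (Tᴴ * T),
      f x = q.eval x := by
    have hfin : (spectrum ℝ (T * Tᴴ) ∪ spectrum ℝ (Tᴴ * T)).Finite :=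
      finite_real_spectrum.union finite_real_spectrum
    refine ⟨Lagrange.interpolate hfin.toFinset id f, fun x hx => ?_⟩
    exact (Lagrange.eval_interpolate_at_node (s := hfin.toFinset) (v := id) f
      Function.injective_id.injOn (i := x) (by simpa using hx)).symm
  rw [cfc_congr (a := T * Tᴴ) (g := q.eval) fun x hx => hq x (Or.inl hx),
    cfc_congr (a := Tᴴ * T) (g := q.eval) fun x hx => hq x (Or.inr hx),
    cfc_polynomial q _ (isHermitian_mul_conjTranspose_self T).isSelfAdjoint,
    cfc_polynomial q _ (isHermitian_conjTranspose_mul_self T).isSelfAdjoint]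
  have hpow : ∀ k : ℕ, (T * Tᴴ) ^ k * T = T * (Tᴴ * T) ^ k := by
    intro k
    induction k with
    | zero => simp
    | succ k ih =>
      rw [pow_succ, pow_succ', Matrix.mul_assoc, Matrix.mul_assoc T, ← Matrix.mul_assoc, ih,
        Matrix.mul_assoc, ← pow_succ, ← pow_succ']
  clear hq
  induction q using Polynomial.induction_on' with
  | add p q hp hq => rw [map_add, map_add, Matrix.add_mul, Matrix.mul_add, hp, hq]
  | monomial k a => rw [aeval_monomial, aeval_monomial, ← Algebra.smul_def, ← Algebra.smul_def,
      Matrix.smul_mul, Matrix.mul_smul, hpow]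

theorem IsHermitian.normSq_coord_comm {H Y : Matrix n n ℂ} (hH : H.IsHermitian)
    (hY : Y.IsHermitian) (i j : n) :
    Complex.normSq (hH.coord hH Y i j) = Complex.normSq (hH.coord hH Y j i) := by
  have h : (hH.coord hH Y)ᴴ = hH.coord hH Y := by
    simp only [IsHermitian.coord, conjTranspose_mul, conjTranspose_conjTranspose, hY.eq,
      Matrix.mul_assoc]
  rw [← h, conjTranspose_apply, Complex.star_def, Complex.normSq_conj, h]

theorem trace_conj_mul_comm {n : Type*} [Fintype n] (S C K : Matrix n n ℂ) :
    (S * C * S * K).trace = (C * (S * K * S)).trace := by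
  rw [Matrix.mul_assoc, Matrix.mul_assoc, trace_mul_comm]
  simp only [Matrix.mul_assoc]

/-! ### The first inequality -/

/-- For `a > 0` the gap is `s |a^(3/2) z - (μ + s a) x|² / (μ + s a)`, so any trial value `x` gives
an upper bound. -/
theorem mul_normSq_div_add_le {a μ s : ℝ} (ha : 0 ≤ a) (hμ : 0 ≤ μ) (hs : 0 < s) (z x : ℂ) :
    μ * a * Complex.normSq z / (μ / a + s) ≤
      a ^ 2 * Complex.normSq z - 2 * s * (a * √a * (z * star x).re)
        + s * (μ * Complex.normSq x) + s ^ 2 * (a * Complex.normSq x) := by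
  rcases ha.eq_or_lt with rfl | ha
  · have := Complex.normSq_nonneg x
    simp only [mul_zero, zero_mul, zero_div]
    have : 0 ≤ s * (μ * Complex.normSq x) := by positivity
    simpa using this
  obtain ⟨r, hr, rfl⟩ : ∃ r, 0 < r ∧ a = r ^ 2 := ⟨√a, by positivity, by simp [ha.le]⟩
  rw [Real.sqrt_sq hr.le]
  have hd : 0 < μ + s * r ^ 2 := by positivity
  rw [show μ * r ^ 2 * Complex.normSq z / (μ / r ^ 2 + s)
    = μ * r ^ 4 * Complex.normSq z / (μ + s * r ^ 2) by field_simp, div_le_iff₀ hd]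
  simp only [Complex.normSq_apply, Complex.star_def, Complex.mul_re, Complex.conj_re,
    Complex.conj_im]
  have h1 := mul_nonneg hs.le (sq_nonneg (r ^ 3 * z.re - (μ + s * r ^ 2) * x.re))
  have h2 := mul_nonneg hs.le (sq_nonneg (r ^ 3 * z.im - (μ + s * r ^ 2) * x.im))
  nlinarith [h1, h2]

theorem symm_resolvent_le {p q s : ℝ} (hp : 0 < p) (hq : 0 < q) (hs : 0 < s) :
    2 - 2 * s * ((p + s)⁻¹ + (q + s)⁻¹) + s * (p * ((q + s)⁻¹) ^ 2 + q * ((p + s)⁻¹) ^ 2)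
      + 2 * s ^ 2 * ((p + s)⁻¹ * (q + s)⁻¹) ≤ p / (q + s) + q / (p + s) := by
  have hp' : 0 < p + s := by positivity
  have hq' : 0 < q + s := by positivity
  have h : p / (q + s) + q / (p + s) - (2 - 2 * s * ((p + s)⁻¹ + (q + s)⁻¹)
      + s * (p * ((q + s)⁻¹) ^ 2 + q * ((p + s)⁻¹) ^ 2)
      + 2 * s ^ 2 * ((p + s)⁻¹ * (q + s)⁻¹)) = p * q * ((p + s)⁻¹ - (q + s)⁻¹) ^ 2 := by
    field_simp
    ring
  have : 0 ≤ p * q * ((p + s)⁻¹ - (q + s)⁻¹) ^ 2 := by positivity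
  linarith

/-- The optimal trial matrix solves `M X + s X A = A^(3/2)`. The choice `X = S Q` with `Q = (B⁻¹ +
s)⁻¹` solves it when `A` and `B` commute, and in general makes the bound computable. -/
theorem sum_resolvent_conj_sqrt_le {A B S M : Matrix n n ℂ} (hA : A.PosSemidef) (hB : B.PosDef)
    (hS : S = cfc Real.sqrt A) (hSM : M = S * B⁻¹ * S) (hM : M.PosSemidef) {s : ℝ} (hs : 0 < s) :
    ∑ i, ∑ j, hM.isHermitian.eigenvalues i * hA.isHermitian.eigenvalues j *
        Complex.normSq (hM.isHermitian.coord hA.isHermitian 1 i j) /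
        (hM.isHermitian.eigenvalues i / hA.isHermitian.eigenvalues j + s) ≤
    ∑ k, ∑ l, (hB.isHermitian.eigenvalues k)⁻¹ *
        Complex.normSq (hB.isHermitian.coord hB.isHermitian A k l) /
        ((hB.isHermitian.eigenvalues l)⁻¹ + s) := by
  have hAH := hA.isHermitian
  have hBH := hB.isHermitian
  have hMH := hM.isHermitian
  have hSS : S * S = A := by
    rw [hS, cfc_mul_cfc, hA.cfc_congr fun x hx => Real.mul_self_sqrt hx, hAH.cfc_id_eq]
  have hSH : Sᴴ = S := by rw [hS, conjTranspose_cfc]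
  set Q : Matrix n n ℂ := cfc (fun x : ℝ => (x⁻¹ + s)⁻¹) B with hQ
  have hQH : Qᴴ = Q := conjTranspose_cfc _ _
  set a := hA.isHermitian.eigenvalues
  set b := hB.isHermitian.eigenvalues
  set μ := hM.isHermitian.eigenvalues
  set z := hM.isHermitian.coord hA.isHermitian 1
  set x := hM.isHermitian.coord hA.isHermitian (S * Q)
  set w := fun k l => Complex.normSq (hB.isHermitian.coord hB.isHermitian A k l)
  -- `f1` to `f4` rewrite the four terms of the quadratic bound as traces in `A` and `B`, expanded
  -- in the eigenbasis of `B`.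
  have f1 : ∑ i, ∑ j, a j ^ 2 * Complex.normSq (z i j) = ∑ k, ∑ l, w k l := by
    have h1 := hMH.trace_cfc_mul_mul_cfc_mul_self hAH (fun _ => 1) (fun x => x * x) 1
    have h2 := hBH.trace_cfc_mul_mul_cfc_mul_self hBH (fun _ => 1) (fun _ => 1) A
    rw [hMH.cfc_one_eq, ← cfc_mul_cfc, hAH.cfc_id_eq] at h1
    rw [hBH.cfc_one_eq, hAH.eq] at h2
    simp only [Matrix.one_mul, Matrix.mul_one, conjTranspose_one] at h1 h2
    have h3 := Complex.ofReal_injective (h1.symm.trans h2)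
    simpa only [one_mul, mul_one, pow_two] using h3
  have f2 : ∑ i, ∑ j, a j * √(a j) * (z i j * star (x i j)).re
      = ∑ k, ∑ l, ((b k)⁻¹ + s)⁻¹ * w k l := by
    have h1 := hMH.trace_cfc_mul_mul_cfc_mul hAH (fun _ => 1) (fun x => x * √x) 1 (S * Q)
    have h2 := hBH.trace_cfc_mul_mul_cfc_mul_self hBH (fun x => (x⁻¹ + s)⁻¹) (fun _ => 1) A
    rw [hMH.cfc_one_eq, ← cfc_mul_cfc, hAH.cfc_id_eq, ← hS] at h1
    rw [hBH.cfc_one_eq, hAH.eq, ← hQ] at h2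
    simp only [Matrix.one_mul, Matrix.mul_one, conjTranspose_mul, hQH, hSH] at h1 h2
    have h0 : (A * S * (Q * S)).trace = (Q * A * A).trace := by
      rw [← hSS, trace_mul_comm]
      simp only [Matrix.mul_assoc]
    have h3 := congrArg Complex.re (h1.symm.trans (h0.trans h2))
    rw [Complex.ofReal_re] at h3
    simp only [Complex.re_sum, Complex.ofReal_one, one_mul, mul_one, Complex.re_ofReal_mul] at h3
    exact h3
  have f3 : ∑ i, ∑ j, μ i * Complex.normSq (x i j)
      = ∑ k, ∑ l, (b k)⁻¹ * (((b l)⁻¹ + s)⁻¹) ^ 2 * w k l := by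
    have h1 := hMH.trace_cfc_mul_mul_cfc_mul_self hAH (fun x => x) (fun _ => 1) (S * Q)
    have h2 := hBH.trace_cfc_mul_mul_cfc_mul_self hBH (fun x => x⁻¹)
      (fun x => (x⁻¹ + s)⁻¹ * (x⁻¹ + s)⁻¹) A
    rw [hMH.cfc_id_eq, hAH.cfc_one_eq] at h1
    rw [← cfc_mul_cfc, ← hQ, hAH.eq, ← hB.inv_eq_cfc] at h2
    simp only [Matrix.mul_one, conjTranspose_mul, hQH, hSH] at h1
    have h0 : (M * (S * Q) * (Q * S)).trace = (B⁻¹ * A * (Q * Q) * A).trace := by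
      rw [hSM]
      calc _ = (S * B⁻¹ * S * (S * Q * Q * S)).trace := by simp only [Matrix.mul_assoc]
        _ = _ := by
          rw [trace_conj_mul_comm, ← hSS]
          simp only [Matrix.mul_assoc]
    have h3 := Complex.ofReal_injective (h1.symm.trans (h0.trans h2))
    simpa only [one_mul, mul_one, pow_two] using h3
  have f4 : ∑ i, ∑ j, a j * Complex.normSq (x i j)
      = ∑ k, ∑ l, ((b k)⁻¹ + s)⁻¹ * ((b l)⁻¹ + s)⁻¹ * w k l := by
    have h1 := hMH.trace_cfc_mul_mul_cfc_mul_self hAH (fun _ => 1) (fun x => x) (S * Q)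
    have h2 := hBH.trace_cfc_mul_mul_cfc_mul_self hBH (fun x => (x⁻¹ + s)⁻¹)
      (fun x => (x⁻¹ + s)⁻¹) A
    rw [hMH.cfc_one_eq, hAH.cfc_id_eq] at h1
    rw [← hQ, hAH.eq] at h2
    simp only [Matrix.one_mul, conjTranspose_mul, hQH, hSH] at h1
    have h0 : (S * Q * A * (Q * S)).trace = (Q * A * Q * A).trace := by
      rw [Matrix.mul_assoc, Matrix.mul_assoc, trace_mul_comm]
      simp only [Matrix.mul_assoc, hSS]
    have h3 := Complex.ofReal_injective (h1.symm.trans (h0.trans h2))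
    simpa only [one_mul] using h3
  have hw : ∀ k l, w k l = w l k := fun k l => hBH.normSq_coord_comm hAH k l
  have hw0 : ∀ k l, 0 ≤ w k l := fun k l => Complex.normSq_nonneg _
  calc _ ≤ ∑ i, ∑ j, (a j ^ 2 * Complex.normSq (z i j)
          - 2 * s * (a j * √(a j) * (z i j * star (x i j)).re)
          + s * (μ i * Complex.normSq (x i j)) + s ^ 2 * (a j * Complex.normSq (x i j))) :=
        Finset.sum_le_sum fun i _ => Finset.sum_le_sum fun j _ =>
          mul_normSq_div_add_le (hA.eigenvalues_nonneg j) (hM.eigenvalues_nonneg i) hs _ _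
    _ = ∑ k, ∑ l, (w k l - 2 * s * (((b k)⁻¹ + s)⁻¹ * w k l)
          + s * ((b k)⁻¹ * (((b l)⁻¹ + s)⁻¹) ^ 2 * w k l)
          + s ^ 2 * (((b k)⁻¹ + s)⁻¹ * ((b l)⁻¹ + s)⁻¹ * w k l)) := by
        have e : ∀ (c : ℝ) (g : n → n → ℝ), ∑ i, ∑ j, c * g i j = c * ∑ i, ∑ j, g i j :=
          fun c g => by simp only [Finset.mul_sum]
        simp only [Finset.sum_add_distrib, Finset.sum_sub_distrib, e (2 * s), e s, e (s ^ 2),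
          f1, f2, f3, f4]
    _ ≤ _ := by
        set G : n → n → ℝ := fun k l => w k l - 2 * s * (((b k)⁻¹ + s)⁻¹ * w k l)
          + s * ((b k)⁻¹ * (((b l)⁻¹ + s)⁻¹) ^ 2 * w k l)
          + s ^ 2 * (((b k)⁻¹ + s)⁻¹ * ((b l)⁻¹ + s)⁻¹ * w k l)
        set R : n → n → ℝ := fun k l => (b k)⁻¹ * w k l / ((b l)⁻¹ + s)
        -- The termwise comparison used holds after symmetrising in `k` and `l`, which is harmless
        -- because `w` is symmetric.
        have hGR : ∑ k, ∑ l, (G k l + G l k) ≤ ∑ k, ∑ l, (R k l + R l k) := by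
          refine Finset.sum_le_sum fun k _ => Finset.sum_le_sum fun l _ => ?_
          have h := mul_le_mul_of_nonneg_right (symm_resolvent_le
            (inv_pos.mpr (hB.eigenvalues_pos k : 0 < b k))
            (inv_pos.mpr (hB.eigenvalues_pos l : 0 < b l)) hs) (hw0 k l)
          simp only [G, R, hw l k]
          refine le_of_eq_of_le ?_ (h.trans_eq ?_) <;> ring
        simp only [Finset.sum_add_distrib] at hGR
        rw [Finset.sum_comm (f := fun k l => G l k), Finset.sum_comm (f := fun k l => R l k)] at hGR
        change ∑ k, ∑ l, G k l ≤ ∑ k, ∑ l, R k l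
        linarith

theorem trace_mul_mul_log_eq {M A : Matrix n n ℂ} (hM : M.IsHermitian) (hA : A.IsHermitian) :
    (M * A * cfc Real.log M).trace =
      (cfc (fun x => x * Real.log x) M * cfc (fun x : ℝ => x) A).trace := by
  have h : cfc (fun x => x * Real.log x) M = cfc Real.log M * M := by
    conv_rhs => arg 2; rw [← hM.cfc_id_eq]
    simp only [cfc_mul_cfc, mul_comm]
  rw [h, hA.cfc_id_eq, trace_mul_comm, Matrix.mul_assoc]

theorem trace_mul_inv_mul_log_sub_log_le {A B S M : Matrix n n ℂ} (hA : A.PosSemidef)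
    (hB : B.PosDef) (hS : S = cfc Real.sqrt A) (hSM : M = S * B⁻¹ * S) (hM : M.PosSemidef) :
    (A * B⁻¹ * A * (cfc Real.log A - cfc Real.log B)).trace ≤ (M * A * cfc Real.log M).trace := by
  have hAH := hA.isHermitian
  have hBH := hB.isHermitian
  have hMH := hM.isHermitian
  have hSS : S * S = A := by
    rw [hS, cfc_mul_cfc, hA.cfc_congr fun x hx => Real.mul_self_sqrt hx, hAH.cfc_id_eq]
  have h1 : (A * B⁻¹ * A * cfc Real.log A).trace = (cfc (fun x : ℝ => x) M *
      cfc (fun x => x * Real.log x) A).trace := by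
    rw [hA.cfc_congr (f := fun x => x * Real.log x) (g := fun x => √x * (Real.log x * √x))
      fun x hx => by rw [mul_comm (Real.log x), ← mul_assoc, Real.mul_self_sqrt hx],
      ← cfc_mul_cfc, ← cfc_mul_cfc Real.log, ← hS, hMH.cfc_id_eq, hSM]
    generalize cfc Real.log A = L
    conv_lhs => rw [← hSS, Matrix.mul_assoc, Matrix.mul_assoc, Matrix.mul_assoc, trace_mul_comm]
    simp only [Matrix.mul_assoc]
  have h2 : (A * B⁻¹ * A * cfc Real.log B).trace =
      (cfc (fun x : ℝ => x⁻¹) B * A * cfc Real.log B * Aᴴ).trace := by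
    rw [hAH.eq, ← hB.inv_eq_cfc, Matrix.mul_assoc, Matrix.mul_assoc, trace_mul_comm]
    simp only [Matrix.mul_assoc]
  have h4 : (cfc (fun x : ℝ => x) M * cfc (fun x : ℝ => x) A).trace =
      (cfc (fun x : ℝ => x⁻¹) B * A * cfc (fun _ : ℝ => (1 : ℝ)) B * Aᴴ).trace := by
    rw [hMH.cfc_id_eq, hAH.cfc_id_eq, hAH.eq, hBH.cfc_one_eq, ← hB.inv_eq_cfc, hSM,
      trace_conj_mul_comm, Matrix.mul_one]
    simp only [← hSS, Matrix.mul_assoc]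
  rw [hMH.trace_cfc_mul_cfc hAH, hBH.trace_cfc_mul_mul_cfc_mul_self hBH] at h4
  have h4 := Complex.ofReal_injective h4
  rw [Matrix.mul_sub, trace_sub, h1, h2, trace_mul_mul_log_eq hMH hAH, hMH.trace_cfc_mul_cfc hAH, hMH.trace_cfc_mul_cfc hAH,
    hBH.trace_cfc_mul_mul_cfc_mul_self hBH, ← Complex.ofReal_sub, Complex.real_le_real]
  have key := sum_mul_log_le_sum_mul_log_of_resolvent_le
    (α := fun p : n × n => hMH.eigenvalues p.1 * hAH.eigenvalues p.2 *
      Complex.normSq (hMH.coord hAH 1 p.1 p.2))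
    (t := fun p => hMH.eigenvalues p.1 / hAH.eigenvalues p.2)
    (β := fun p : n × n => (hBH.eigenvalues p.1)⁻¹ * Complex.normSq (hBH.coord hBH A p.1 p.2))
    (r := fun p => (hBH.eigenvalues p.2)⁻¹)
    (fun p => div_nonneg (hM.eigenvalues_nonneg _) (hA.eigenvalues_nonneg _))
    (fun p => inv_nonneg.mpr (hB.eigenvalues_pos _).le)
    -- The ratio `μ/a` is also `0` when `a = 0`; the weight `μ a |z|²` vanishes in either case.
    (fun p hp => by rcases div_eq_zero_iff.mp hp with h | h <;> simp [h])
    (fun p hp => absurd hp (inv_pos.mpr (hB.eigenvalues_pos p.2)).ne')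
    (by simpa only [Fintype.sum_prod_type, mul_one] using h4)
    (fun s hs => by
      simpa only [Fintype.sum_prod_type] using sum_resolvent_conj_sqrt_le hA hB hS hSM hM hs)
  simp only [Fintype.sum_prod_type] at key
  have e1 : ∑ i, ∑ j, hMH.eigenvalues i * hAH.eigenvalues j *
      Complex.normSq (hMH.coord hAH 1 i j) * Real.log (hMH.eigenvalues i / hAH.eigenvalues j) =
      ∑ i, ∑ j, hMH.eigenvalues i * Real.log (hMH.eigenvalues i) * hAH.eigenvalues j *
        Complex.normSq (hMH.coord hAH 1 i j) -
      ∑ i, ∑ j, hMH.eigenvalues i * (hAH.eigenvalues j * Real.log (hAH.eigenvalues j)) *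
        Complex.normSq (hMH.coord hAH 1 i j) := by
    simp only [← Finset.sum_sub_distrib]
    refine Finset.sum_congr rfl fun i _ => Finset.sum_congr rfl fun j _ => ?_
    by_cases hi : hMH.eigenvalues i = 0
    · simp [hi]
    by_cases hj : hAH.eigenvalues j = 0
    · simp [hj]
    rw [Real.log_div hi hj]
    ring
  have e2 : ∑ i, ∑ j, (hBH.eigenvalues i)⁻¹ * Complex.normSq (hBH.coord hBH A i j) *
      Real.log (hBH.eigenvalues j)⁻¹ = - ∑ i, ∑ j, (hBH.eigenvalues i)⁻¹ *
      Real.log (hBH.eigenvalues j) * Complex.normSq (hBH.coord hBH A i j) := by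
    simp only [← Finset.sum_neg_distrib, Real.log_inv]
    refine Finset.sum_congr rfl fun i _ => Finset.sum_congr rfl fun j _ => ?_
    ring
  rw [e1, e2] at key
  linarith

/-! ### The second inequality -/

theorem IsHermitian.conj_eigenvectorUnitary_apply_self {H : Matrix n n ℂ} (hH : H.IsHermitian)
    (Z W : Matrix n n ℂ) (i : n) :
    ((hH.eigenvectorUnitary : Matrix n n ℂ)ᴴ * (Zᴴ * W) * hH.eigenvectorUnitary) i i =
      ∑ l, (W * (hH.eigenvectorUnitary : Matrix n n ℂ)) l i *
        star ((Z * (hH.eigenvectorUnitary : Matrix n n ℂ)) l i) := by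
  rw [show (hH.eigenvectorUnitary : Matrix n n ℂ)ᴴ * (Zᴴ * W) * hH.eigenvectorUnitary =
    (Z * (hH.eigenvectorUnitary : Matrix n n ℂ))ᴴ * (W * hH.eigenvectorUnitary) by
      simp only [conjTranspose_mul, Matrix.mul_assoc], mul_apply]
  simp only [conjTranspose_apply, mul_comm]

theorem IsHermitian.trace_cfc_mul {H : Matrix n n ℂ} (hH : H.IsHermitian) (f : ℝ → ℝ)
    (X : Matrix n n ℂ) : (cfc f H * X).trace = ∑ i, (f (hH.eigenvalues i) : ℂ) *
      ((hH.eigenvectorUnitary : Matrix n n ℂ)ᴴ * X * hH.eigenvectorUnitary) i i := by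
  rw [hH.cfc_eq_conj, Matrix.mul_assoc, Matrix.mul_assoc, trace_mul_comm, Matrix.mul_assoc, trace]
  simp only [diag_apply, diagonal_mul]

theorem IsHermitian.trace_cfc_mul_conjTranspose_mul {H : Matrix n n ℂ} (hH : H.IsHermitian)
    (f : ℝ → ℝ) (Z : Matrix n n ℂ) :
    (cfc f H * (Zᴴ * Z)).trace = ((∑ i, f (hH.eigenvalues i) *
      ∑ l, Complex.normSq ((Z * (hH.eigenvectorUnitary : Matrix n n ℂ)) l i) : ℝ) : ℂ) := by
  rw [hH.trace_cfc_mul]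
  simp only [hH.conj_eigenvectorUnitary_apply_self, Complex.star_def, Complex.mul_conj]
  push_cast
  rfl

/-- Expand `‖p - c g‖² ≥ 0` and `‖r - c g‖² ≥ 0` with `c = ν / (ν + s)`, and add them with weights
`ν` and `s`; `hpr` merges the cross terms. -/
theorem two_mul_re_sub_le {n : Type*} [Fintype n] {ν s : ℝ} (hν : 0 ≤ ν) (hs : 0 < s) (g p r : n → ℂ)
    (hpr : ∑ l, p l * star (g l) = ∑ l, g l * star (r l)) :
    2 * (ν * (∑ l, g l * star (r l)).re) - ν * ∑ l, Complex.normSq (p l)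
      - s * ∑ l, Complex.normSq (r l) ≤ ν ^ 2 * (∑ l, Complex.normSq (g l)) / (ν + s) := by
  have hd : 0 < ν + s := by positivity
  set c := ν / (ν + s) with hc
  have hcν : c * (ν + s) = ν := by rw [hc]; field_simp
  have h1 : 2 * c * (∑ l, g l * star (r l)).re - ∑ l, Complex.normSq (p l)
      ≤ c ^ 2 * ∑ l, Complex.normSq (g l) := by
    rw [← hpr, Complex.re_sum, Finset.mul_sum, Finset.mul_sum, ← Finset.sum_sub_distrib]
    refine Finset.sum_le_sum fun l _ => ?_
    simp only [Complex.normSq_apply, Complex.star_def, Complex.mul_re, Complex.conj_re,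
      Complex.conj_im]
    nlinarith [sq_nonneg ((p l).re - c * (g l).re), sq_nonneg ((p l).im - c * (g l).im)]
  have h2 : 2 * c * (∑ l, g l * star (r l)).re - ∑ l, Complex.normSq (r l)
      ≤ c ^ 2 * ∑ l, Complex.normSq (g l) := by
    rw [Complex.re_sum, Finset.mul_sum, Finset.mul_sum, ← Finset.sum_sub_distrib]
    refine Finset.sum_le_sum fun l _ => ?_
    simp only [Complex.normSq_apply, Complex.star_def, Complex.mul_re, Complex.conj_re,
      Complex.conj_im]
    nlinarith [sq_nonneg ((r l).re - c * (g l).re), sq_nonneg ((r l).im - c * (g l).im)]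
  have h3 : ν ^ 2 * (∑ l, Complex.normSq (g l)) / (ν + s)
      = (ν + s) * (c ^ 2 * ∑ l, Complex.normSq (g l)) := by
    rw [hc]; field_simp
  rw [h3]
  set q := (∑ l, g l * star (r l)).re
  have h4 : ν * q = c * (ν + s) * q := by rw [hcν]
  have := mul_le_mul_of_nonneg_left h1 hν
  have := mul_le_mul_of_nonneg_left h2 hs.le
  nlinarith

/-- The left side is the maximum over `Y` of `2 Re Tr A Yᴴ - Tr A Y Yᴴ - s Tr Y B Yᴴ`. Substituting
`A = D N D` and `B = D D` splits this over the eigenvectors of `N`. -/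
theorem sum_resolvent_le_conj_rsqrt {A B D N : Matrix n n ℂ} (hA : A.PosSemidef) (hB : B.PosDef)
    (hD : D.IsHermitian) (hDD : D * D = B) (hN : N.PosSemidef) (hDN : A = D * N * D)
    {s : ℝ} (hs : 0 < s) :
    ∑ j, ∑ k, hA.isHermitian.eigenvalues j ^ 2 * (hB.isHermitian.eigenvalues k)⁻¹ *
        Complex.normSq (hA.isHermitian.coord hB.isHermitian 1 j k) /
        (hA.isHermitian.eigenvalues j / hB.isHermitian.eigenvalues k + s) ≤
    ∑ i, hN.isHermitian.eigenvalues i ^ 2 *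
        (∑ l, Complex.normSq ((D * (hN.isHermitian.eigenvectorUnitary : Matrix n n ℂ)) l i)) /
        (hN.isHermitian.eigenvalues i + s) := by
  have hAH := hA.isHermitian
  have hBH := hB.isHermitian
  have hNH := hN.isHermitian
  have hDH := hD.eq
  set a := hA.isHermitian.eigenvalues with ha
  set b := hB.isHermitian.eigenvalues with hb
  set ν := hN.isHermitian.eigenvalues with hν
  set z := hA.isHermitian.coord hB.isHermitian 1 with hz
  set U := (hA.isHermitian.eigenvectorUnitary : Matrix n n ℂ) with hU
  set V := (hB.isHermitian.eigenvectorUnitary : Matrix n n ℂ) with hV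
  set F := (hN.isHermitian.eigenvectorUnitary : Matrix n n ℂ) with hF
  -- The maximiser solves `A Y + s Y B = A`; its coordinates are those of `1` times `a / (a + s b)`.
  set y : n → n → ℝ := fun j k => (a j / b k) / (a j / b k + s) with hy
  have hUU : Uᴴ * U = 1 := Unitary.coe_star_mul_self hA.isHermitian.eigenvectorUnitary
  have hVV : Vᴴ * V = 1 := Unitary.coe_star_mul_self hB.isHermitian.eigenvectorUnitary
  obtain ⟨Y, hYc⟩ : ∃ Y : Matrix n n ℂ,
      ∀ j k, hA.isHermitian.coord hB.isHermitian Y j k = y j k * z j k := by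
    refine ⟨U * (of fun j k => (y j k : ℂ) * z j k) * Vᴴ, fun j k => ?_⟩
    rw [IsHermitian.coord, ← hU, ← hV, show Uᴴ * (U * (of fun j k => (y j k : ℂ) * z j k) * Vᴴ) * V
      = (Uᴴ * U) * (of fun j k => (y j k : ℂ) * z j k) * (Vᴴ * V) by
        simp only [Matrix.mul_assoc], hUU, hVV, Matrix.one_mul, Matrix.mul_one, of_apply]
  have g1 : ∑ j, ∑ k, a j * y j k * Complex.normSq (z j k) =
      ∑ i, ν i * (∑ l, (D * F) l i * star ((Y * D * F) l i)).re := by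
    have h1 := hAH.trace_cfc_mul_mul_cfc_mul hBH (fun x => x) (fun _ => 1) 1 Y
    have h2 := hNH.trace_cfc_mul (fun x => x) ((Y * D)ᴴ * D)
    simp only [hNH.conj_eigenvectorUnitary_apply_self] at h2
    rw [hAH.cfc_id_eq, hBH.cfc_one_eq, Matrix.mul_one, Matrix.mul_one] at h1
    rw [hNH.cfc_id_eq] at h2
    have h0 : (A * Yᴴ).trace = (N * ((Y * D)ᴴ * D)).trace := by
      rw [hDN, trace_conj_mul_comm, conjTranspose_mul, hDH]
    have h3 := congrArg Complex.re (h1.symm.trans (h0.trans h2))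
    simp only [Complex.re_sum, Complex.re_ofReal_mul, Complex.ofReal_one, mul_one] at h3
    rw [← hF, ← hν] at h3
    simp only [Complex.re_sum]
    rw [← h3]
    refine Finset.sum_congr rfl fun j _ => Finset.sum_congr rfl fun k _ => ?_
    rw [hYc j k]
    simp only [hz, Complex.normSq_apply, Complex.star_def, map_mul, Complex.mul_re, Complex.conj_re,
      Complex.conj_im, Complex.ofReal_re, Complex.ofReal_im, Complex.mul_im, ← ha]
    ring
  have g2 : ∑ j, ∑ k, a j * y j k ^ 2 * Complex.normSq (z j k) =
      ∑ i, ν i * ∑ l, Complex.normSq ((Yᴴ * D * F) l i) := by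
    have h1 := hAH.trace_cfc_mul_mul_cfc_mul_self hBH (fun x => x) (fun _ => 1) Y
    have h2 := hNH.trace_cfc_mul_conjTranspose_mul (fun x => x) (Yᴴ * D)
    rw [hAH.cfc_id_eq, hBH.cfc_one_eq, Matrix.mul_one] at h1
    rw [hNH.cfc_id_eq] at h2
    have h0 : (A * Y * Yᴴ).trace = (N * ((Yᴴ * D)ᴴ * (Yᴴ * D))).trace := by
      rw [hDN, conjTranspose_mul, conjTranspose_conjTranspose, hDH, Matrix.mul_assoc,
        trace_conj_mul_comm]
      simp only [Matrix.mul_assoc]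
    have h3 := Complex.ofReal_injective (h1.symm.trans (h0.trans h2))
    rw [← h3]
    refine Finset.sum_congr rfl fun j _ => Finset.sum_congr rfl fun k _ => ?_
    rw [hYc j k, Complex.normSq_mul, Complex.normSq_ofReal]
    ring
  have g3 : ∑ j, ∑ k, b k * y j k ^ 2 * Complex.normSq (z j k) =
      ∑ i, ∑ l, Complex.normSq ((Y * D * F) l i) := by
    have h1 := hAH.trace_cfc_mul_mul_cfc_mul_self hBH (fun _ => 1) (fun x => x) Y
    have h2 := hNH.trace_cfc_mul_conjTranspose_mul (fun _ => 1) (Y * D)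
    rw [hBH.cfc_id_eq, hAH.cfc_one_eq, Matrix.one_mul] at h1
    rw [hNH.cfc_one_eq, Matrix.one_mul] at h2
    have h0 : (Y * B * Yᴴ).trace = ((Y * D)ᴴ * (Y * D)).trace := by
      rw [trace_mul_comm _ (Y * D), conjTranspose_mul, hDH, ← hDD]
      simp only [Matrix.mul_assoc]
    have h3 := Complex.ofReal_injective (h1.symm.trans (h0.trans h2))
    simp only [one_mul] at h3
    rw [← h3]
    refine Finset.sum_congr rfl fun j _ => Finset.sum_congr rfl fun k _ => ?_
    rw [hYc j k, Complex.normSq_mul, Complex.normSq_ofReal]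
    ring
  calc _ = ∑ j, ∑ k, (2 * (a j * y j k * Complex.normSq (z j k))
          - a j * y j k ^ 2 * Complex.normSq (z j k)
          - s * (b k * y j k ^ 2 * Complex.normSq (z j k))) := by
        refine Finset.sum_congr rfl fun j _ => Finset.sum_congr rfl fun k _ => ?_
        have hbk : 0 < b k := hB.eigenvalues_pos k
        have haj : 0 ≤ a j := hA.eigenvalues_nonneg j
        have : 0 < a j + s * b k := by positivity
        simp only [hy]
        field_simp
        ring
    _ = ∑ i, (2 * (ν i * (∑ l, (D * F) l i * star ((Y * D * F) l i)).re)
          - ν i * ∑ l, Complex.normSq ((Yᴴ * D * F) l i)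
          - s * ∑ l, Complex.normSq ((Y * D * F) l i)) := by
        simp only [Finset.sum_sub_distrib, ← Finset.mul_sum, g2, g3, ← g1]
    _ ≤ _ := by
        refine Finset.sum_le_sum fun i _ => two_mul_re_sub_le (hN.eigenvalues_nonneg i) hs _ _ _ ?_
        rw [← hNH.conj_eigenvectorUnitary_apply_self D (Yᴴ * D),
          ← hNH.conj_eigenvectorUnitary_apply_self (Y * D) D, conjTranspose_mul, hDH, Matrix.mul_assoc D]

theorem trace_conj_rsqrt_mul_log_le {A B E N : Matrix n n ℂ} (hA : A.PosSemidef)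
    (hB : B.PosDef) (hE : E = cfc (fun x => (√x)⁻¹) B) (hEN : N = E * A * E)
    (hN : N.PosSemidef) :
    (E * A ^ 2 * E * cfc Real.log N).trace ≤
      (A ^ 2 * B⁻¹ * (cfc Real.log A - cfc Real.log B)).trace := by
  have hAH := hA.isHermitian
  have hBH := hB.isHermitian
  have hNH := hN.isHermitian
  obtain ⟨D, hD⟩ : ∃ D, D = cfc Real.sqrt B := ⟨_, rfl⟩
  have hDH : Dᴴ = D := by rw [hD, conjTranspose_cfc]
  have hDD : D * D = B := by
    rw [hD, cfc_mul_cfc, hB.cfc_congr fun x hx => Real.mul_self_sqrt hx.le, hBH.cfc_id_eq]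
  have hDE : D * E = 1 := by
    rw [hD, hE, cfc_mul_cfc, hB.cfc_congr (g := fun _ => 1)
      fun x hx => mul_inv_cancel₀ (Real.sqrt_pos.mpr hx).ne', hBH.cfc_one_eq]
  have hED : E * D = 1 := mul_eq_one_comm.mp hDE
  have hEE : E * E = B⁻¹ := by
    rw [hE, cfc_mul_cfc, hB.inv_eq_cfc]
    exact hB.cfc_congr fun x hx => by rw [← mul_inv, Real.mul_self_sqrt hx.le]
  have hDN : A = D * N * D := by
    rw [hEN, show D * (E * A * E) * D = (D * E) * A * (E * D) by simp only [Matrix.mul_assoc],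
      hDE, hED, Matrix.one_mul, Matrix.mul_one]
  -- Yields the weights `ν² ‖D f‖²` at the eigenvalues `ν` of `N`, with `f` the eigenvectors.
  have hNBN : E * A ^ 2 * E = N * (Dᴴ * D) * N := by
    rw [hEN, hDH, show E * A * E * (D * D) * (E * A * E) = E * A * (E * D) * (D * E) * A * E by
      simp only [Matrix.mul_assoc], hDE, hED, Matrix.mul_one, Matrix.mul_one, pow_two]
    simp only [Matrix.mul_assoc]
  have h1 : (E * A ^ 2 * E * cfc Real.log N).trace =
      (cfc (fun x => x * Real.log x * x) N * (Dᴴ * D)).trace := by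
    rw [hNBN, ← cfc_mul_cfc (fun x => x * Real.log x), ← cfc_mul_cfc (fun x => x), hNH.cfc_id_eq,
      Matrix.mul_assoc, trace_mul_comm]
    simp only [Matrix.mul_assoc]
  have h2 : (A ^ 2 * B⁻¹ * cfc Real.log A).trace =
      (cfc (fun x => Real.log x * (x * x)) A * cfc (fun x : ℝ => x⁻¹) B).trace := by
    rw [← cfc_mul_cfc Real.log, ← cfc_mul_cfc (fun x => x), hAH.cfc_id_eq, trace_mul_comm,
      ← hB.inv_eq_cfc, pow_two]
    simp only [Matrix.mul_assoc]
  have h3 : (A ^ 2 * B⁻¹ * cfc Real.log B).trace =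
      (cfc (fun x : ℝ => x * x) A * cfc (fun x : ℝ => x⁻¹ * Real.log x) B).trace := by
    rw [← cfc_mul_cfc (fun x => x), ← cfc_mul_cfc (fun x => x⁻¹), hAH.cfc_id_eq,
      ← hB.inv_eq_cfc, pow_two]
    simp only [Matrix.mul_assoc]
  have h4 : (cfc (fun x : ℝ => x * x) A * cfc (fun x : ℝ => x⁻¹) B).trace =
      (cfc (fun x : ℝ => x * x) N * (Dᴴ * D)).trace := by
    rw [← cfc_mul_cfc (fun x => x), ← cfc_mul_cfc (fun x => x), hAH.cfc_id_eq, hNH.cfc_id_eq,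
      ← hB.inv_eq_cfc]
    calc (A * A * B⁻¹).trace = (E * A ^ 2 * E).trace := by
          rw [Matrix.mul_assoc E, trace_mul_comm E, Matrix.mul_assoc _ E, hEE, pow_two]
      _ = (N * N * (Dᴴ * D)).trace := by
          rw [hNBN, trace_mul_comm, ← Matrix.mul_assoc]
  rw [hAH.trace_cfc_mul_cfc hBH, hNH.trace_cfc_mul_conjTranspose_mul] at h4
  have h4 := Complex.ofReal_injective h4
  rw [Matrix.mul_sub, trace_sub, h1, h2, h3, hAH.trace_cfc_mul_cfc hBH, hAH.trace_cfc_mul_cfc hBH,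
    hNH.trace_cfc_mul_conjTranspose_mul, ← Complex.ofReal_sub, Complex.real_le_real]
  have key := sum_mul_log_le_sum_mul_log_of_resolvent_le
    (α := fun p : n × n => hAH.eigenvalues p.1 ^ 2 * (hBH.eigenvalues p.2)⁻¹ *
      Complex.normSq (hAH.coord hBH 1 p.1 p.2))
    (t := fun p => hAH.eigenvalues p.1 / hBH.eigenvalues p.2)
    (β := fun i => hNH.eigenvalues i ^ 2 *
      ∑ l, Complex.normSq ((D * (hNH.eigenvectorUnitary : Matrix n n ℂ)) l i))
    (r := hNH.eigenvalues)
    (fun p => div_nonneg (hA.eigenvalues_nonneg _) (hB.eigenvalues_pos _).le)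
    (fun i => hN.eigenvalues_nonneg i)
    (fun p hp => by rcases div_eq_zero_iff.mp hp with h | h <;> simp [h])
    (fun i hi => by simp [hi])
    (by simpa only [Fintype.sum_prod_type, pow_two] using h4)
    (fun s hs => by
      simpa only [Fintype.sum_prod_type] using
        sum_resolvent_le_conj_rsqrt hA hB hDH hDD hN hDN hs)
  simp only [Fintype.sum_prod_type] at key
  refine le_of_eq_of_le ?_ (key.trans_eq ?_)
  · refine Finset.sum_congr rfl fun i _ => ?_
    ring
  · simp only [← Finset.sum_sub_distrib]
    refine Finset.sum_congr rfl fun i _ => Finset.sum_congr rfl fun j _ => ?_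
    by_cases hi : hAH.eigenvalues i = 0
    · simp [hi]
    rw [Real.log_div hi (hB.eigenvalues_pos j).ne']
    ring

end Matrix

/-- Real powers of positive matrices are those of the continuous functional calculus, and
`cfc Real.log` is the matrix logarithm; on a singular matrix it takes the value `0` on the
kernel, which is the convention `0 log 0 = 0`. The traces are compared in `ℂ`, where `z ≤ w`
means `z.re ≤ w.re` and `z.im = w.im`; the first conjunct says that they are all real. -/
theorem proposition7p1 (n : ℕ) (A B : Matrix (Fin n) (Fin n) ℂ)
    (hA : A.PosSemidef) (hB : B.PosDef) :
    (A ^ (1 / 2 : ℝ) * B⁻¹ * A ^ (3 / 2 : ℝ) *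
        cfc Real.log (A ^ (1 / 2 : ℝ) * B⁻¹ * A ^ (1 / 2 : ℝ))).trace.im = 0 ∧
    (A * B⁻¹ * A * (cfc Real.log A - cfc Real.log B)).trace ≤
      (A ^ (1 / 2 : ℝ) * B⁻¹ * A ^ (3 / 2 : ℝ) *
        cfc Real.log (A ^ (1 / 2 : ℝ) * B⁻¹ * A ^ (1 / 2 : ℝ))).trace ∧
    (A ^ (1 / 2 : ℝ) * B⁻¹ * A ^ (3 / 2 : ℝ) *
        cfc Real.log (A ^ (1 / 2 : ℝ) * B⁻¹ * A ^ (1 / 2 : ℝ))).trace =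
      (B ^ (-(1 / 2) : ℝ) * A ^ 2 * B ^ (-(1 / 2) : ℝ) *
        cfc Real.log (B ^ (-(1 / 2) : ℝ) * A * B ^ (-(1 / 2) : ℝ))).trace ∧
    (B ^ (-(1 / 2) : ℝ) * A ^ 2 * B ^ (-(1 / 2) : ℝ) *
        cfc Real.log (B ^ (-(1 / 2) : ℝ) * A * B ^ (-(1 / 2) : ℝ))).trace =
      (A ^ (3 / 2 : ℝ) * B⁻¹ * A ^ (1 / 2 : ℝ) *
        cfc Real.log (A ^ (1 / 2 : ℝ) * B⁻¹ * A ^ (1 / 2 : ℝ))).trace ∧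
    (A ^ (3 / 2 : ℝ) * B⁻¹ * A ^ (1 / 2 : ℝ) *
        cfc Real.log (A ^ (1 / 2 : ℝ) * B⁻¹ * A ^ (1 / 2 : ℝ))).trace ≤
      (A ^ 2 * B⁻¹ * (cfc Real.log A - cfc Real.log B)).trace := by
  have hAH := hA.isHermitian
  have hBH := hB.isHermitian
  obtain ⟨S, hS⟩ : ∃ S, S = cfc Real.sqrt A := ⟨_, rfl⟩
  obtain ⟨E, hE⟩ : ∃ E, E = cfc (fun x => (√x)⁻¹) B := ⟨_, rfl⟩
  have hSS : S * S = A := by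
    rw [hS, Matrix.cfc_mul_cfc, hA.cfc_congr fun x hx => Real.mul_self_sqrt hx, hAH.cfc_id_eq]
  have hEE : E * E = B⁻¹ := by
    rw [hE, Matrix.cfc_mul_cfc, hB.inv_eq_cfc]
    exact hB.cfc_congr fun x hx => by rw [← mul_inv, Real.mul_self_sqrt hx.le]
  have hSH : S.conjTranspose = S := by rw [hS, Matrix.conjTranspose_cfc]
  have hEH : E.conjTranspose = E := by rw [hE, Matrix.conjTranspose_cfc]
  have hA12 : A ^ (1 / 2 : ℝ) = S := by
    rw [CFC.rpow_eq_cfc_real hA.nonneg, hS]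
    exact hA.cfc_congr fun x _ => (Real.sqrt_eq_rpow x).symm
  have hA32 : A ^ (3 / 2 : ℝ) = S * S * S := by
    rw [CFC.rpow_eq_cfc_real hA.nonneg, hS, Matrix.cfc_mul_cfc, Matrix.cfc_mul_cfc]
    refine hA.cfc_congr fun x hx => ?_
    rw [Real.mul_self_sqrt hx, Real.sqrt_eq_rpow, ← Real.rpow_one_add' hx (by norm_num)]
    norm_num
  have hB12 : B ^ (-(1 / 2) : ℝ) = E := by
    rw [CFC.rpow_eq_cfc_real hB.posSemidef.nonneg, hE]
    exact hB.cfc_congr fun x hx => by rw [Real.sqrt_eq_rpow, Real.rpow_neg hx.le]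
  rw [hA12, hA32, hB12]
  obtain ⟨M, hSM⟩ : ∃ M, M = S * B⁻¹ * S := ⟨_, rfl⟩
  obtain ⟨N, hEN⟩ : ∃ N, N = E * A * E := ⟨_, rfl⟩
  have hMT : M = (S * E) * (S * E).conjTranspose := by
    rw [hSM, Matrix.conjTranspose_mul, hSH, hEH, ← hEE]
    simp only [Matrix.mul_assoc]
  have hNT : N = (S * E).conjTranspose * (S * E) := by
    rw [hEN, Matrix.conjTranspose_mul, hSH, hEH, ← hSS]
    simp only [Matrix.mul_assoc]
  have hM : M.PosSemidef := hMT ▸ Matrix.posSemidef_self_mul_conjTranspose _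
  have hN : N.PosSemidef := hNT ▸ Matrix.posSemidef_conjTranspose_mul_self _
  have hMH := hM.isHermitian
  have m1 : S * B⁻¹ * (S * S * S) = M * A := by
    rw [hSM, ← hSS]; simp only [Matrix.mul_assoc]
  have m3 : S * S * S * B⁻¹ * S = A * M := by
    rw [hSM, ← hSS]; simp only [Matrix.mul_assoc]
  rw [m1, m3, ← hSM, ← hEN]
  have hcomm : M * cfc Real.log M = cfc Real.log M * M := by
    nth_rewrite 1 4 [← hMH.cfc_id_eq]
    simp only [Matrix.cfc_mul_cfc, mul_comm]
  have e13 : (M * A * cfc Real.log M).trace = (A * M * cfc Real.log M).trace := by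
    rw [Matrix.mul_assoc A, hcomm, Matrix.mul_assoc, Matrix.trace_mul_comm, Matrix.mul_assoc]
  have e23 : (E * A ^ 2 * E * cfc Real.log N).trace = (A * M * cfc Real.log M).trace := by
    -- With `T = S E`, this moves the logarithm from `M = T Tᴴ` to `N = Tᴴ T`.
    have hlogT : cfc Real.log M * (S * E) = (S * E) * cfc Real.log N := by
      rw [hMT, hNT, Matrix.cfc_mul_conjTranspose_mul]
    rw [Matrix.mul_assoc A, hcomm]
    nth_rewrite 2 [hMT]
    rw [← Matrix.mul_assoc (cfc _ _), hlogT, Matrix.conjTranspose_mul, hSH, hEH,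
      ← Matrix.mul_assoc, Matrix.trace_mul_comm _ (E * S), pow_two, ← hSS]
    simp only [Matrix.mul_assoc]
  refine ⟨?_, Matrix.trace_mul_inv_mul_log_sub_log_le hA hB hS hSM hM, e13.trans e23.symm, e23, ?_⟩
  · rw [Matrix.trace_mul_mul_log_eq hMH hAH, hMH.trace_cfc_mul_cfc hAH, Complex.ofReal_im]
  · rw [← e23]
    exact Matrix.trace_conj_rsqrt_mul_log_le hA hB hE hEN hN
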